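/- Let $A,B\in\mathbb C^{n\times n}$ be such that the pencil $zB-A$ is regular, i.e. $\det(zB-A)$ is not identically zero in $z\in\mathbb C$. An eigenpair of $Ax=\lambda Bx$ is a pair $(\lambda,x)\in\mathbb C\times\mathbb C^n$ with $x\neq 0$ and $Ax=\lambda Bx$; then $\lambda$ is an eigenvalue, and its (algebraic) multiplicity is its multiplicity as a root of $\det(zB-A)$. The same terms are used for any square pencil. Let $\Gamma$ be a positively oriented, piecewise continuously differentiable, simple closed curve in $\mathbb C$ that passes through no eigenvalue of $Ax=\lambda Bx$, and let $s$ be the number of eigenvalues inside $\Gamma$, counted with multiplicity. Put $$Q=\frac{1}{2\pi\sqrt{-1}}\oint_\Gamma (zB-A)^{-1}B\,dz .$$ Let $Y$ and $R$ be random $n\times s$ matrices on a common probability space (real or complex). The entries of $Y$ are independent and identically distributed with a continuous distribution (one that gives no mass to single points), and so are the entries of $R$. No relation between $Y$ and $R$ is assumed. Define $$U=QY,\qquad \widetilde A=R^*AU,\qquad \widetilde B=R^*BU .$$ Then, with probability $1$, all of the following hold. 1. The $s\times s$ pencil $z\widetilde B-\widetilde A$ is regular, and its eigenvalues, with their multiplicities,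 are exactly the eigenvalues of $Ax=\lambda Bx$ inside $\Gamma$, with their multiplicities. 2. If $(\tilde\lambda,y)$ is an eigenpair of $\widetilde A y=\tilde\lambda\widetilde B y$, then $\tilde\lambda$ lies inside $\Gamma$ and $(\tilde\lambda,Uy)$ is an eigenpair of $Ax=\lambda Bx$ (in particular $Uy\neq 0$). 3. Conversely, for every eigenpair $(\lambda,x)$ of $Ax=\lambda Bx$ with $\lambda$ inside $\Gamma$ there is exactly one $y$ such that $(\lambda,y)$ is an eigenpair of $\widetilde A y=\tilde\lambda\widetilde B y$ and $Uy=x$. -/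

import Mathlib

open MeasureTheory ProbabilityTheory Polynomial Matrix Set

noncomputable section

namespace Feast

/-! ### Matrix pencils `z B - A` -/

/-- The pencil `z B - A` is regular: `det (z B - A)` does not vanish identically in `z`. -/
def IsRegularPencil {m : ℕ} (A B : Matrix (Fin m) (Fin m) ℂ) : Prop :=
  ∃ z : ℂ, (z • B - A).det ≠ 0

/-- `(μ, x)` is an eigenpair of `A x = μ B x`. -/
def IsEigenpair {m : ℕ} (A B : Matrix (Fin m) (Fin m) ℂ) (μ : ℂ) (x : Fin m → ℂ) : Prop :=
  x ≠ 0 ∧ A *ᵥ x = μ • (B *ᵥ x)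

/-- The characteristic polynomial `det (z B - A)` of the pencil, as a polynomial in `z`. -/
def pencilCharpoly {m : ℕ} (A B : Matrix (Fin m) (Fin m) ℂ) : ℂ[X] :=
  (((X : ℂ[X]) • B.map C) - A.map C).det

/-- The (finite) eigenvalues of a regular pencil, each repeated according to its algebraic
multiplicity, that is, its multiplicity as a root of `det (z B - A)`. -/
def eigenvalues {m : ℕ} (A B : Matrix (Fin m) (Fin m) ℂ) : Multiset ℂ :=
  (pencilCharpoly A B).roots

/-! ### Closed curves and contour integrals -/

/-- The contour integral `∮ f(z) dz` along `γ : [a, b] → ℂ`. -/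
def contourIntegral (γ : ℝ → ℂ) (a b : ℝ) (f : ℂ → ℂ) : ℂ :=
  ∫ t in a..b, deriv γ t * f (γ t)

/-- The points inside the closed curve `γ : [a, b] → ℂ`: those off the curve that lie in a bounded
connected component of the complement of the curve. -/
def inside (γ : ℝ → ℂ) (a b : ℝ) : Set ℂ :=
  {w | w ∉ γ '' Icc a b ∧
    Bornology.IsBounded (connectedComponentIn (γ '' Icc a b)ᶜ w)}

/-- `γ` is continuous on `[a, b]`, and continuously differentiable (one-sidedly at end points) on
each closed piece of some finite partition of `[a, b]`. -/
def IsPiecewiseC1 (γ : ℝ → ℂ) (a b : ℝ) : Prop :=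
  ContinuousOn γ (Icc a b) ∧
    ∃ (k : ℕ) (t : Fin (k + 1) → ℝ), StrictMono t ∧ t 0 = a ∧ t (Fin.last k) = b ∧
      ∀ i : Fin k, ContDiffOn ℝ 1 γ (Icc (t i.castSucc) (t i.succ))

/-- `γ : [a, b] → ℂ` is a positively oriented, piecewise continuously differentiable, simple
closed curve. Positive orientation means that the curve winds exactly once, counterclockwise,
around each point inside it. -/
structure IsPositiveSimpleClosedCurve (γ : ℝ → ℂ) (a b : ℝ) : Prop where
  lt : a < b
  piecewise : IsPiecewiseC1 γ a b
  closed : γ a = γ b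
  simple : InjOn γ (Ico a b)
  positive : ∀ w ∈ inside γ a b,
    (2 * Real.pi * Complex.I)⁻¹ * contourIntegral γ a b (fun z => (z - w)⁻¹) = 1

open Classical in
/-- The eigenvalues of the pencil `z B - A` inside the curve, repeated according to their
algebraic multiplicities. -/
def eigenvaluesInside {m : ℕ} (A B : Matrix (Fin m) (Fin m) ℂ) (γ : ℝ → ℂ) (a b : ℝ) :
    Multiset ℂ :=
  (eigenvalues A B).filter (fun μ => μ ∈ inside γ a b)

/-- The matrix `Q = (2πi)⁻¹ ∮ (z B - A)⁻¹ B dz`, the integral being taken entrywise. -/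
def spectralProjector {m : ℕ} (A B : Matrix (Fin m) (Fin m) ℂ) (γ : ℝ → ℂ) (a b : ℝ) :
    Matrix (Fin m) (Fin m) ℂ :=
  Matrix.of fun i j =>
    (2 * Real.pi * Complex.I)⁻¹ * contourIntegral γ a b (fun z => ((z • B - A)⁻¹ * B) i j)

/-! ### Random matrices -/

/-- The entries of the random matrix `Y` are independent, identically distributed random variables
with a continuous distribution, that is, one which gives no mass to single points. (Real random
matrices are the special case of entries with values in `ℝ ⊆ ℂ`.) -/
structure IsIIDContinuous {Ω : Type*} [MeasurableSpace Ω] (P : Measure Ω) {n s : ℕ}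
    (Y : Ω → Matrix (Fin n) (Fin s) ℂ) : Prop where
  indep : iIndepFun (fun (p : Fin n × Fin s) (ω : Ω) => Y ω p.1 p.2) P
  ident : ∀ p q : Fin n × Fin s,
    IdentDistrib (fun ω => Y ω p.1 p.2) (fun ω => Y ω q.1 q.2) P P
  continuous : ∀ (p : Fin n × Fin s) (c : ℂ), P {ω | Y ω p.1 p.2 = c} = 0

end Feast

end

noncomputable section

namespace Feast

/-! Fix a regular point `z₀` and put `M = (z₀ B - A)⁻¹ B`. The generalized eigenspaces of `M` span
the whole space; `ν ≠ 0` belongs to the eigenvalue `z₀ - ν⁻¹` of the pencil, and `ν = 0` to its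
infinite part. On each of them the resolvent identity reduces the integral defining `Q` to integrals
of powers of `z - w`. These have primitives, except for the winding integral, which is `2πi` inside
the curve and `0` outside. So `Q` is the identity or zero on each generalized eigenspace
(`spectralProjector_genEigenspace`), hence an idempotent commuting with `M`; no canonical form of
the pencil is needed.

Factor `Q = S T` with `T S = 1`. Then `A S = B S J`, where the characteristic roots of `J` are the
eigenvalues inside, and `B S` has a left inverse (`exists_compression`). With `L = T Y` and `G = R*
B S` one gets `U = S L` and `z B' - A' = G (z - J) L`, so all claims follow once `G` and `L` are
invertible. Their determinants, the first up to conjugation, are nonzero polynomials in independent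
atomless variables, hence almost surely nonzero (`IsIIDContinuous.ae_det_mul_ne_zero`). Two almost
sure events always intersect in one, whatever the joint law of `Y` and `R`. -/

/-! ### Piecewise continuously differentiable curves -/

theorem exists_mem_Ioo_of_le_partition {t : ℕ → ℝ} {x : ℝ} (h0 : t 0 ≤ x) :
    ∀ m : ℕ, x ≤ t m → (∀ i, i ≤ m → x ≠ t i) → ∃ i < m, x ∈ Ioo (t i) (t (i + 1))
  | 0, h, hne => absurd (le_antisymm h h0) (hne 0 le_rfl)
  | m + 1, h, hne => by
    by_cases hx : x ≤ t m
    · obtain ⟨i, hi, hxi⟩ := exists_mem_Ioo_of_le_partition h0 m hx fun i hi => hne i (by omega)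
      exact ⟨i, by omega, hxi⟩
    · exact ⟨m, by omega, not_le.1 hx, lt_of_le_of_ne h (hne _ le_rfl)⟩

theorem hasDerivAt_of_contDiffOn_Icc {γ : ℝ → ℂ} {c d x : ℝ} (h : ContDiffOn ℝ 1 γ (Icc c d))
    (hx : x ∈ Ioo c d) : HasDerivAt γ (deriv γ x) x :=
  (((h.differentiableOn one_ne_zero) x (Ioo_subset_Icc_self hx)).differentiableAt
    (Icc_mem_nhds hx.1 hx.2)).hasDerivAt

theorem intervalIntegrable_deriv_of_contDiffOn_Icc {γ : ℝ → ℂ} {c d : ℝ} (hcd : c < d)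
    (h : ContDiffOn ℝ 1 γ (Icc c d)) : IntervalIntegrable (deriv γ) volume c d := by
  have h1 : ContinuousOn (derivWithin γ (Icc c d)) (Icc c d) :=
    h.continuousOn_derivWithin (uniqueDiffOn_Icc hcd) le_rfl
  have h2 : IntervalIntegrable (derivWithin γ (Icc c d)) volume c d :=
    ContinuousOn.intervalIntegrable (by rwa [uIcc_of_le hcd.le])
  -- The end points are dropped because `deriv γ` and the one-sided derivative may differ there.
  rw [intervalIntegrable_iff_integrableOn_Ioo_of_le hcd.le] at h2 ⊢
  refine h2.congr_fun (fun x hx => ?_) measurableSet_Ioo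
  exact derivWithin_of_mem_nhds (Icc_mem_nhds hx.1 hx.2)

/-- A piecewise continuously differentiable curve has an integrable derivative, which is a genuine
derivative off a finite set. -/
theorem IsPiecewiseC1.exists_countable {γ : ℝ → ℂ} {a b : ℝ} (h : IsPiecewiseC1 γ a b) :
    IntervalIntegrable (deriv γ) volume a b ∧
      ∃ E : Set ℝ, E.Countable ∧ ∀ x ∈ Ioo a b \ E, HasDerivAt γ (deriv γ x) x := by
  obtain ⟨-, k, t, ht, h0, hk, hC⟩ := h
  -- Clamping the index turns the partition into a sequence on `ℕ`, so that the pieces can be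
  -- chained.
  let t' : ℕ → ℝ := fun i => t ⟨min i k, by omega⟩
  have e0 : t' 0 = a := by rw [← h0]; rfl
  have ek : t' k = b := by
    rw [← hk]; simp only [t', min_self]; rfl
  have hC' : ∀ i < k, t' i < t' (i + 1) ∧ ContDiffOn ℝ 1 γ (Icc (t' i) (t' (i + 1))) := by
    intro i hi
    have e1 : t' i = t (Fin.castSucc ⟨i, hi⟩) := by
      simp only [t']; congr 1; ext; simp; omega
    have e2 : t' (i + 1) = t (Fin.succ ⟨i, hi⟩) := by
      simp only [t']; congr 1; ext; simp; omega
    rw [e1, e2]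
    exact ⟨ht (Fin.castSucc_lt_succ), hC _⟩
  constructor
  · rw [← e0, ← ek]
    exact IntervalIntegrable.trans_iterate fun i hi =>
      intervalIntegrable_deriv_of_contDiffOn_Icc (hC' i hi).1 (hC' i hi).2
  · refine ⟨range t, (finite_range t).countable, fun x hx => ?_⟩
    obtain ⟨i, hi, hxi⟩ := exists_mem_Ioo_of_le_partition (t := t') (x := x)
      (by rw [e0]; exact hx.1.1.le) k (by rw [ek]; exact hx.1.2.le)
      (fun i _ he => hx.2 ⟨_, he.symm⟩)
    exact hasDerivAt_of_contDiffOn_Icc (hC' i hi).2 hxi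

/-! ### Contour integrals of powers and winding numbers -/

section Contour

variable {γ : ℝ → ℂ} {a b : ℝ}

theorem IsPositiveSimpleClosedCurve.isCompact_image (hγ : IsPositiveSimpleClosedCurve γ a b) :
    IsCompact (γ '' Icc a b) :=
  isCompact_Icc.image_of_continuousOn hγ.piecewise.1

theorem IsPositiveSimpleClosedCurve.intervalIntegrable (hγ : IsPositiveSimpleClosedCurve γ a b)
    {f : ℂ → ℂ} (hf : ContinuousOn f (γ '' Icc a b)) :
    IntervalIntegrable (fun t => deriv γ t * f (γ t)) volume a b := by
  refine hγ.piecewise.exists_countable.1.mul_continuousOn ?_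
  rw [uIcc_of_le hγ.lt.le]
  exact hf.comp hγ.piecewise.1 (mapsTo_image _ _)

theorem contourIntegral_const_mul (c : ℂ) (f : ℂ → ℂ) :
    contourIntegral γ a b (fun z => c * f z) = c * contourIntegral γ a b f := by
  rw [contourIntegral, contourIntegral, ← intervalIntegral.integral_const_mul]
  congr 1; ext t; ring

theorem IsPositiveSimpleClosedCurve.contourIntegral_congr
    (hγ : IsPositiveSimpleClosedCurve γ a b) {f g : ℂ → ℂ} (h : EqOn f g (γ '' Icc a b)) :
    contourIntegral γ a b f = contourIntegral γ a b g := by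
  refine intervalIntegral.integral_congr fun t ht => ?_
  rw [uIcc_of_le hγ.lt.le] at ht
  simp only [h (mem_image_of_mem γ ht)]

theorem IsPositiveSimpleClosedCurve.contourIntegral_add (hγ : IsPositiveSimpleClosedCurve γ a b)
    {f g : ℂ → ℂ} (hf : ContinuousOn f (γ '' Icc a b)) (hg : ContinuousOn g (γ '' Icc a b)) :
    contourIntegral γ a b (fun z => f z + g z) =
      contourIntegral γ a b f + contourIntegral γ a b g := by
  rw [contourIntegral, contourIntegral, contourIntegral,
    ← intervalIntegral.integral_add (hγ.intervalIntegrable hf) (hγ.intervalIntegrable hg)]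
  congr 1; ext t; ring

theorem IsPositiveSimpleClosedCurve.contourIntegral_sum (hγ : IsPositiveSimpleClosedCurve γ a b)
    {ι : Type*} (s : Finset ι) {f : ι → ℂ → ℂ}
    (hf : ∀ i ∈ s, ContinuousOn (f i) (γ '' Icc a b)) :
    contourIntegral γ a b (fun z => ∑ i ∈ s, f i z) = ∑ i ∈ s, contourIntegral γ a b (f i) := by
  simp only [contourIntegral, Finset.mul_sum]
  exact intervalIntegral.integral_finsetSum fun i hi => hγ.intervalIntegrable (hf i hi)

/-- The integral of a continuous derivative along a closed curve vanishes. -/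
theorem IsPositiveSimpleClosedCurve.contourIntegral_eq_zero
    (hγ : IsPositiveSimpleClosedCurve γ a b) {F f : ℂ → ℂ}
    (hF : ∀ z ∈ γ '' Icc a b, HasDerivAt F (f z) z) (hf : ContinuousOn f (γ '' Icc a b)) :
    contourIntegral γ a b f = 0 := by
  obtain ⟨-, E, hE, hd⟩ := hγ.piecewise.exists_countable
  have hFc : ContinuousOn (F ∘ γ) (Icc a b) := by
    refine ContinuousOn.comp (t := γ '' Icc a b) (fun z hz => ?_) hγ.piecewise.1 (mapsTo_image _ _)
    exact (hF z hz).continuousAt.continuousWithinAt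
  have := integral_eq_of_hasDerivAt_off_countable_of_le (F ∘ γ)
    (fun t => deriv γ t * f (γ t)) hγ.lt.le hE hFc (fun x hx => ?_) (hγ.intervalIntegrable hf)
  · rw [contourIntegral, this]
    simp [hγ.closed]
  · have := (hF (γ x) (mem_image_of_mem γ (Ioo_subset_Icc_self hx.1))).scomp x (hd x hx)
    simpa using this

theorem IsPositiveSimpleClosedCurve.norm_contourIntegral_le
    (hγ : IsPositiveSimpleClosedCurve γ a b) {f : ℂ → ℂ} {C : ℝ}
    (hC : ∀ z ∈ γ '' Icc a b, ‖f z‖ ≤ C) :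
    ‖contourIntegral γ a b f‖ ≤ (∫ t in a..b, ‖deriv γ t‖) * C := by
  rw [← intervalIntegral.integral_mul_const]
  refine intervalIntegral.norm_integral_le_of_norm_le hγ.lt.le ?_
    (hγ.piecewise.exists_countable.1.norm.mul_const C)
  refine Filter.Eventually.of_forall fun t ht => ?_
  rw [norm_mul]
  exact mul_le_mul_of_nonneg_left (hC _ (mem_image_of_mem γ (Ioc_subset_Icc_self ht)))
    (norm_nonneg _)

theorem IsPositiveSimpleClosedCurve.contourIntegral_pow (hγ : IsPositiveSimpleClosedCurve γ a b)
    (w : ℂ) (j : ℕ) : contourIntegral γ a b (fun z => (z - w) ^ j) = 0 := by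
  refine hγ.contourIntegral_eq_zero (F := fun z => (z - w) ^ (j + 1) / (j + 1)) (fun z _ => ?_)
    (by fun_prop)
  have h := (((hasDerivAt_id z).sub_const w).pow (j + 1)).div_const ((j : ℂ) + 1)
  refine h.congr_deriv ?_
  have : (j : ℂ) + 1 ≠ 0 := by exact_mod_cast j.succ_ne_zero
  simp
  field_simp

theorem continuousOn_inv_sub_pow {K : Set ℂ} {w : ℂ} (hw : w ∉ K) (j : ℕ) :
    ContinuousOn (fun z => ((z - w)⁻¹) ^ j) K := by
  refine (ContinuousOn.inv₀ (by fun_prop) fun z hz => ?_).pow j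
  exact sub_ne_zero.2 fun h => hw (h ▸ hz)

/-- Exponents at most `-2` still have a single-valued primitive off `w`; the excluded exponent `-1`
is the winding integral. -/
theorem IsPositiveSimpleClosedCurve.contourIntegral_inv_pow
    (hγ : IsPositiveSimpleClosedCurve γ a b) {w : ℂ} (hw : w ∉ γ '' Icc a b) (j : ℕ) :
    contourIntegral γ a b (fun z => ((z - w)⁻¹) ^ (j + 2)) = 0 := by
  refine hγ.contourIntegral_eq_zero (F := fun z => -((z - w)⁻¹) ^ (j + 1) / (j + 1))
    (fun z hz => ?_) (continuousOn_inv_sub_pow hw _)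
  have hzw : z - w ≠ 0 := sub_ne_zero.2 fun h => hw (h ▸ hz)
  have h := (((((hasDerivAt_id z).sub_const w).inv hzw).pow (j + 1)).neg).div_const ((j : ℂ) + 1)
  refine h.congr_deriv ?_
  have : (j : ℂ) + 1 ≠ 0 := by exact_mod_cast j.succ_ne_zero
  simp
  field_simp
  ring

/-- The winding integral has derivative zero off the curve. -/
theorem IsPositiveSimpleClosedCurve.hasDerivAt_winding (hγ : IsPositiveSimpleClosedCurve γ a b)
    {w : ℂ} (hw : w ∉ γ '' Icc a b) :
    HasDerivAt (fun w => contourIntegral γ a b (fun z => (z - w)⁻¹)) 0 w := by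
  obtain ⟨d, hd, hball⟩ := Metric.isOpen_iff.1 hγ.isCompact_image.isClosed.isOpen_compl w hw
  have hfar : ∀ z ∈ γ '' Icc a b, d ≤ ‖z - w‖ := fun z hz => by
    by_contra! h
    exact hball (show z ∈ Metric.ball w d by rwa [Metric.mem_ball, dist_eq_norm]) hz
  set L := ∫ t in a..b, ‖deriv γ t‖
  -- The first-order term in `v - w` is the integral of `(z - w)⁻²`, which vanishes, so the
  -- increment is quadratic. Halving the radius keeps `v` at distance `d / 2` from the curve, whence
  -- the constant `(d / 2)⁻¹ d⁻²`.
  have key : ∀ v ∈ Metric.ball w (d / 2),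
      ‖contourIntegral γ a b (fun z => (z - v)⁻¹) - contourIntegral γ a b (fun z => (z - w)⁻¹)‖
        ≤ L * (2 / d ^ 3) * ‖v - w‖ ^ 2 := by
    intro v hv
    rw [Metric.mem_ball, dist_eq_norm] at hv
    have hfar' : ∀ z ∈ γ '' Icc a b, d / 2 ≤ ‖z - v‖ := fun z hz => by
      have h1 := hfar z hz
      have h2 : ‖z - w‖ ≤ ‖z - v‖ + ‖v - w‖ := by
        simpa using norm_add_le (z - v) (v - w)
      linarith
    have hv' : v ∉ γ '' Icc a b := fun h => by
      have := hfar' v h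
      simp at this; linarith
    have cw := fun j => continuousOn_inv_sub_pow hw j
    have cv := by simpa using continuousOn_inv_sub_pow hv' 1
    have e : contourIntegral γ a b (fun z => (z - v)⁻¹) =
        contourIntegral γ a b (fun z => (z - w)⁻¹) + (v - w) ^ 2 *
          contourIntegral γ a b (fun z => (z - v)⁻¹ * ((z - w)⁻¹) ^ 2) := by
      have h0 := hγ.contourIntegral_inv_pow hw 0
      calc _ = contourIntegral γ a b (fun z => ((z - w)⁻¹ + (v - w) * ((z - w)⁻¹) ^ (0 + 2)) +
              (v - w) ^ 2 * ((z - v)⁻¹ * ((z - w)⁻¹) ^ 2)) := by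
            refine hγ.contourIntegral_congr fun z hz => ?_
            have h1 : z - w ≠ 0 := sub_ne_zero.2 fun h => hw (h ▸ hz)
            have h2 : z - v ≠ 0 := sub_ne_zero.2 fun h => hv' (h ▸ hz)
            have h3 : v - w = (z - w) - (z - v) := by ring
            simp only [h3, zero_add]
            generalize z - w = p at h1 ⊢
            generalize z - v = q at h2 ⊢
            field_simp
            ring
        _ = _ := by
            have c1 : ContinuousOn (fun z : ℂ => (z - w)⁻¹) (γ '' Icc a b) := by simpa using cw 1
            have c2 : ContinuousOn (fun z : ℂ => (v - w) * ((z - w)⁻¹) ^ (0 + 2)) (γ '' Icc a b) :=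
              continuousOn_const.mul (cw _)
            have c3 : ContinuousOn (fun z : ℂ => (v - w) ^ 2 * ((z - v)⁻¹ * ((z - w)⁻¹) ^ 2))
                (γ '' Icc a b) := continuousOn_const.mul (cv.mul (cw 2))
            have c12 : ContinuousOn (fun z : ℂ => (z - w)⁻¹ + (v - w) * ((z - w)⁻¹) ^ (0 + 2))
                (γ '' Icc a b) := c1.add c2
            rw [hγ.contourIntegral_add c12 c3, hγ.contourIntegral_add c1 c2, contourIntegral_const_mul,
              contourIntegral_const_mul, h0]
            ring
    rw [e, add_sub_cancel_left, norm_mul, norm_pow, mul_comm]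
    refine mul_le_mul_of_nonneg_right (hγ.norm_contourIntegral_le fun z hz => ?_) (by positivity)
    rw [norm_mul, norm_pow, norm_inv, norm_inv]
    calc ‖z - v‖⁻¹ * ‖z - w‖⁻¹ ^ 2 ≤ (d / 2)⁻¹ * d⁻¹ ^ 2 := by
          have h1 := hfar z hz
          have h2 := hfar' z hz
          gcongr
      _ = 2 / d ^ 3 := by field_simp
  rw [hasDerivAt_iff_isLittleO]
  have hO : (fun v => contourIntegral γ a b (fun z => (z - v)⁻¹) -
      contourIntegral γ a b (fun z => (z - w)⁻¹) - (v - w) • (0 : ℂ)) =O[nhds w]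
      fun v => ‖v - w‖ ^ 2 := by
    refine Asymptotics.IsBigO.of_bound (L * (2 / d ^ 3)) ?_
    filter_upwards [Metric.ball_mem_nhds w (half_pos hd)] with v hv
    simpa using key v hv
  refine hO.trans_isLittleO ?_
  have h1 : Filter.Tendsto (fun v => ‖v - w‖) (nhds w) (nhds 0) := by
    have : Continuous fun v : ℂ => ‖v - w‖ := by fun_prop
    simpa using this.tendsto w
  have h2 : (fun v => ‖v - w‖ ^ 2) =o[nhds w] fun v => ‖v - w‖ :=
    (Asymptotics.isLittleO_pow_id one_lt_two).comp_tendsto h1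
  exact h2.of_norm_right

/-- The curve does not wind around the points outside it. -/
theorem IsPositiveSimpleClosedCurve.winding_eq_zero (hγ : IsPositiveSimpleClosedCurve γ a b)
    {w : ℂ} (hw : w ∉ γ '' Icc a b) (hw' : w ∉ inside γ a b) :
    contourIntegral γ a b (fun z => (z - w)⁻¹) = 0 := by
  set K := γ '' Icc a b with hK
  set V := connectedComponentIn Kᶜ w with hV
  have hopen : IsOpen V := hγ.isCompact_image.isClosed.isOpen_compl.connectedComponentIn
  have hsub : V ⊆ Kᶜ := connectedComponentIn_subset _ _
  have hunb : ¬ Bornology.IsBounded V := fun h => hw' ⟨hw, h⟩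
  set I : ℂ → ℂ := fun w => contourIntegral γ a b (fun z => (z - w)⁻¹) with hI
  have hconst : ∀ v ∈ V, I v = I w := fun v hv =>
    hopen.is_const_of_deriv_eq_zero isPreconnected_connectedComponentIn
      (fun u hu => (hγ.hasDerivAt_winding (hsub hu)).differentiableAt.differentiableWithinAt)
      (fun u hu => (hγ.hasDerivAt_winding (hsub hu)).deriv) hv (mem_connectedComponentIn hw)
  obtain ⟨C, hC⟩ := hγ.isCompact_image.isBounded.exists_norm_le
  set L := ∫ t in a..b, ‖deriv γ t‖
  have hL : 0 ≤ L := intervalIntegral.integral_nonneg hγ.lt.le fun _ _ => norm_nonneg _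
  -- The winding integral is constant on the unbounded component, which contains points arbitrarily
  -- far from the curve.
  have key : ∀ r : ℝ, 0 < r → ‖I w‖ ≤ L * r⁻¹ := by
    intro r hr
    obtain ⟨v, hv, hvr⟩ : ∃ v ∈ V, C + r < ‖v‖ := by
      by_contra! h
      exact hunb (isBounded_iff_forall_norm_le.2 ⟨_, h⟩)
    rw [← hconst v hv]
    refine hγ.norm_contourIntegral_le fun z hz => ?_
    rw [norm_inv]
    have h1 := hC z hz
    have h2 := norm_sub_norm_le v z
    rw [norm_sub_rev] at h2
    exact inv_anti₀ hr (by linarith)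
  have hlim : Filter.Tendsto (fun r : ℝ => L * r⁻¹) Filter.atTop (nhds 0) := by
    simpa using tendsto_inv_atTop_zero.const_mul L
  have : ‖I w‖ ≤ 0 := ge_of_tendsto hlim
    ((Filter.eventually_gt_atTop 0).mono key)
  exact norm_le_zero_iff.1 this

end Contour

/-! ### The spectral projector on generalized eigenspaces -/

section Projector

variable {n : ℕ} {A B : Matrix (Fin n) (Fin n) ℂ} {γ : ℝ → ℂ} {a b : ℝ} {z₀ : ℂ}

theorem det_ne_zero_of_forall_not_isEigenpair {z : ℂ}
    (h : ∀ x : Fin n → ℂ, ¬ IsEigenpair A B z x) : (z • B - A).det ≠ 0 := fun h0 => by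
  obtain ⟨x, hx, hx'⟩ := exists_mulVec_eq_zero_iff.2 h0
  refine h x ⟨hx, ?_⟩
  rw [sub_mulVec, smul_mulVec, sub_eq_zero] at hx'
  exact hx'.symm

/-- A pencil in terms of its value at a regular point. -/
theorem pencil_eq_mul (h₀ : (z₀ • B - A).det ≠ 0) (z : ℂ) :
    z • B - A = (z₀ • B - A) * (1 + (z - z₀) • ((z₀ • B - A)⁻¹ * B)) := by
  rw [mul_add, mul_one, Matrix.mul_smul, mul_nonsing_inv_cancel_left _ _ h₀.isUnit, sub_smul]
  abel

/-- The resolvent `(z B - A)⁻¹ B` as a function of its value at a regular point. -/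
theorem resolvent_eq (h₀ : (z₀ • B - A).det ≠ 0) {z : ℂ} (hz : (z • B - A).det ≠ 0) :
    (z • B - A)⁻¹ * B + (z - z₀) • ((z • B - A)⁻¹ * B * ((z₀ • B - A)⁻¹ * B)) =
      (z₀ • B - A)⁻¹ * B := by
  have e : (z₀ • B - A)⁻¹ = (z • B - A)⁻¹ * ((z • B - A) * (z₀ • B - A)⁻¹) := by
    rw [nonsing_inv_mul_cancel_left _ _ hz.isUnit]
  have e2 : z • B - A = (z₀ • B - A) + (z - z₀) • B := by rw [sub_smul]; abel
  have e3 : (z₀ • B - A)⁻¹ = (z • B - A)⁻¹ + (z - z₀) • ((z • B - A)⁻¹ * B * (z₀ • B - A)⁻¹) := by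
    conv_lhs => rw [e]
    conv_lhs => rw [show (z • B - A) * (z₀ • B - A)⁻¹ = 1 + (z - z₀) • (B * (z₀ • B - A)⁻¹) by
      rw [e2, add_mul, mul_nonsing_inv _ h₀.isUnit, smul_mul]]
    rw [mul_add, mul_one, Matrix.mul_smul, mul_assoc]
  conv_rhs => rw [e3]
  rw [add_mul, smul_mul, Matrix.mul_assoc _ (z₀ • B - A)⁻¹ B]

theorem resolvent_mulVec (h₀ : (z₀ • B - A).det ≠ 0) {z : ℂ} (hz : (z • B - A).det ≠ 0)
    (x : Fin n → ℂ) :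
    ((z • B - A)⁻¹ * B) *ᵥ x + (z - z₀) • (((z • B - A)⁻¹ * B) *ᵥ (((z₀ • B - A)⁻¹ * B) *ᵥ x)) =
      ((z₀ • B - A)⁻¹ * B) *ᵥ x := by
  conv_rhs => rw [← resolvent_eq h₀ hz]
  rw [add_mulVec, smul_mulVec, mulVec_mulVec]

theorem continuousOn_resolvent {K : Set ℂ} (hK : ∀ z ∈ K, (z • B - A).det ≠ 0)
    (x : Fin n → ℂ) (i : Fin n) :
    ContinuousOn (fun z : ℂ => (((z • B - A)⁻¹ * B) *ᵥ x) i) K := by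
  have h1 : Continuous fun z : ℂ => z • B - A := by fun_prop
  have h2 : Continuous fun z : ℂ => (((z • B - A).adjugate * B) *ᵥ x) i :=
    (continuous_apply i).comp ((h1.matrix_adjugate.matrix_mul continuous_const).matrix_mulVec
      continuous_const)
  refine ((h1.matrix_det.continuousOn.inv₀ hK).mul h2.continuousOn).congr fun z hz => ?_
  rw [inv_def, Ring.inverse_eq_inv', smul_mul, smul_mulVec]
  rfl

theorem spectralProjector_mulVec (hγ : IsPositiveSimpleClosedCurve γ a b)
    (hK : ∀ z ∈ γ '' Icc a b, (z • B - A).det ≠ 0) (x : Fin n → ℂ) (i : Fin n) :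
    (spectralProjector A B γ a b *ᵥ x) i = (2 * Real.pi * Complex.I)⁻¹ *
      contourIntegral γ a b (fun z => (((z • B - A)⁻¹ * B) *ᵥ x) i) := by
  have hc : ∀ j, ContinuousOn (fun z : ℂ => x j * (((z • B - A)⁻¹ * B) i j)) (γ '' Icc a b) := by
    intro j
    refine continuousOn_const.mul ?_
    simpa using continuousOn_resolvent hK (Pi.single j 1) i
  have e : (fun z : ℂ => (((z • B - A)⁻¹ * B) *ᵥ x) i) =
      fun z => ∑ j, x j * (((z • B - A)⁻¹ * B) i j) := by
    ext z
    simp only [mulVec, dotProduct, mul_comm]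
  rw [e, hγ.contourIntegral_sum _ fun j _ => hc j, Finset.mul_sum]
  simp only [mulVec, dotProduct, spectralProjector, of_apply, contourIntegral_const_mul]
  exact Finset.sum_congr rfl fun j _ => by ring

/-- The resolvent identity trades `x` for `M x` at the price of a factor `z - z₀` and a polynomial
term with zero integral. The induction therefore carries an arbitrary power `j`. -/
theorem contourIntegral_resolvent_of_nilpotent (hγ : IsPositiveSimpleClosedCurve γ a b)
    (hK : ∀ z ∈ γ '' Icc a b, (z • B - A).det ≠ 0) (h₀ : (z₀ • B - A).det ≠ 0) (i : Fin n) :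
    ∀ (k : ℕ) (x : Fin n → ℂ), (((z₀ • B - A)⁻¹ * B) ^ k) *ᵥ x = 0 → ∀ j : ℕ,
      contourIntegral γ a b (fun z => (z - z₀) ^ j * (((z • B - A)⁻¹ * B) *ᵥ x) i) = 0
  | 0, x, hx, j => by
    have : x = 0 := by simpa using hx
    simp [this, contourIntegral]
  | k + 1, x, hx, j => by
    set M := (z₀ • B - A)⁻¹ * B with hM
    have ih := contourIntegral_resolvent_of_nilpotent hγ hK h₀ i k (M *ᵥ x)
      (by rw [mulVec_mulVec, ← pow_succ]; exact hx) (j + 1)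
    have e : contourIntegral γ a b (fun z => (z - z₀) ^ j * (((z • B - A)⁻¹ * B) *ᵥ x) i) =
        contourIntegral γ a b (fun z => (M *ᵥ x) i * (z - z₀) ^ j +
          (-1) * ((z - z₀) ^ (j + 1) * (((z • B - A)⁻¹ * B) *ᵥ (M *ᵥ x)) i)) := by
      refine hγ.contourIntegral_congr fun z hz => ?_
      have := congrFun (resolvent_mulVec h₀ (hK z hz) x) i
      simp only [Pi.add_apply, Pi.smul_apply, smul_eq_mul] at this
      simp only [hM]
      rw [← this]
      ring
    have c1 : ContinuousOn (fun z : ℂ => (M *ᵥ x) i * (z - z₀) ^ j) (γ '' Icc a b) := by fun_prop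
    have c2 : ContinuousOn (fun z : ℂ => (-1) * ((z - z₀) ^ (j + 1) *
        (((z • B - A)⁻¹ * B) *ᵥ (M *ᵥ x)) i)) (γ '' Icc a b) :=
      continuousOn_const.mul ((by fun_prop : Continuous fun z : ℂ =>
        (z - z₀) ^ (j + 1)).continuousOn.mul (continuousOn_resolvent hK _ i))
    rw [e, hγ.contourIntegral_add c1 c2, contourIntegral_const_mul, contourIntegral_const_mul, ih,
      hγ.contourIntegral_pow]
    ring

/-- With `M x = ν x + y`, where `y` has lower order, the resolvent identity expresses the resolvent
at `x` through that at `y`, with one more factor `(z - l)⁻¹`, `l = z₀ - ν⁻¹`. Hence the free power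
`j`. -/
theorem contourIntegral_resolvent_of_genEigenvector (hγ : IsPositiveSimpleClosedCurve γ a b)
    (hK : ∀ z ∈ γ '' Icc a b, (z • B - A).det ≠ 0) (h₀ : (z₀ • B - A).det ≠ 0)
    {ν : ℂ} (hν : ν ≠ 0) (hl : z₀ - ν⁻¹ ∉ γ '' Icc a b) (i : Fin n) :
    ∀ (k : ℕ) (x : Fin n → ℂ), (((z₀ • B - A)⁻¹ * B - ν • 1) ^ k) *ᵥ x = 0 → ∀ j : ℕ,
      contourIntegral γ a b
          (fun z => ((z - (z₀ - ν⁻¹))⁻¹) ^ j * (((z • B - A)⁻¹ * B) *ᵥ x) i) =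
        x i * contourIntegral γ a b (fun z => ((z - (z₀ - ν⁻¹))⁻¹) ^ (j + 1))
  | 0, x, hx, j => by
    have : x = 0 := by simpa using hx
    simp [this, contourIntegral]
  | k + 1, x, hx, j => by
    set M := (z₀ • B - A)⁻¹ * B with hM
    set l := z₀ - ν⁻¹ with hl'
    set y := (M - ν • 1) *ᵥ x with hy
    have hyk : ((M - ν • 1) ^ k) *ᵥ y = 0 := by
      rw [hy, mulVec_mulVec, ← pow_succ]; exact hx
    have hMx : M *ᵥ x = ν • x + y := by
      rw [hy, sub_mulVec, smul_mulVec, one_mulVec]; abel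
    have ih := contourIntegral_resolvent_of_genEigenvector hγ hK h₀ hν hl i k y hyk
    have cw := continuousOn_inv_sub_pow hl
    have cG := fun y : Fin n → ℂ => continuousOn_resolvent hK y i
    have e : contourIntegral γ a b (fun z => ((z - l)⁻¹) ^ j * (((z • B - A)⁻¹ * B) *ᵥ x) i) =
        contourIntegral γ a b (fun z => (x i + ν⁻¹ * y i) * ((z - l)⁻¹) ^ (j + 1) +
          ((-ν⁻¹) * (((z - l)⁻¹) ^ j * (((z • B - A)⁻¹ * B) *ᵥ y) i) +
            (ν⁻¹ ^ 2) * (((z - l)⁻¹) ^ (j + 1) * (((z • B - A)⁻¹ * B) *ᵥ y) i))) := by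
      refine hγ.contourIntegral_congr fun z hz => ?_
      have hzl : z - l ≠ 0 := sub_ne_zero.2 fun h => hl (h ▸ hz)
      have h := congrFun (resolvent_mulVec h₀ (hK z hz) x) i
      rw [← hM, hMx, mulVec_add, mulVec_smul] at h
      simp only [Pi.add_apply, Pi.smul_apply, smul_eq_mul] at h
      generalize (((z • B - A)⁻¹ * B) *ᵥ x) i = g at h ⊢
      generalize (((z • B - A)⁻¹ * B) *ᵥ y) i = g' at h ⊢
      have hz₀ : z - z₀ = (z - l) - ν⁻¹ := by rw [hl']; ring
      rw [hz₀] at h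
      -- The coefficient of `g` in `h` is `1 + (z - z₀) ν = ν (z - l)`.
      have hg : g = (z - l)⁻¹ * (x i + ν⁻¹ * y i) - ν⁻¹ * g' + (z - l)⁻¹ * ν⁻¹ ^ 2 * g' := by
        generalize z - l = u at hzl h ⊢
        field_simp at h ⊢
        linear_combination h
      rw [hg]
      ring
    have c1 : ContinuousOn (fun z : ℂ => (x i + ν⁻¹ * y i) * ((z - l)⁻¹) ^ (j + 1))
      (γ '' Icc a b) := continuousOn_const.mul (cw _)
    have c2 : ContinuousOn (fun z : ℂ => (-ν⁻¹) * (((z - l)⁻¹) ^ j *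
      (((z • B - A)⁻¹ * B) *ᵥ y) i)) (γ '' Icc a b) :=
      continuousOn_const.mul ((cw _).mul (cG _))
    have c3 : ContinuousOn (fun z : ℂ => (ν⁻¹ ^ 2) * (((z - l)⁻¹) ^ (j + 1) *
      (((z • B - A)⁻¹ * B) *ᵥ y) i)) (γ '' Icc a b) :=
      continuousOn_const.mul ((cw _).mul (cG _))
    have c23 : ContinuousOn (fun z : ℂ => (-ν⁻¹) * (((z - l)⁻¹) ^ j *
      (((z • B - A)⁻¹ * B) *ᵥ y) i) + (ν⁻¹ ^ 2) * (((z - l)⁻¹) ^ (j + 1) *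
      (((z • B - A)⁻¹ * B) *ᵥ y) i)) (γ '' Icc a b) := c2.add c3
    -- The two `ν⁻¹ * y i` contributions cancel, and the `ν⁻¹ ^ 2` term has a pole of order `j + 2`,
    -- so it integrates to zero.
    rw [e, hγ.contourIntegral_add c1 c23, hγ.contourIntegral_add c2 c3, contourIntegral_const_mul,
      contourIntegral_const_mul, contourIntegral_const_mul, ih, ih (j + 1),
      hγ.contourIntegral_inv_pow hl j]
    ring

/-- Eigenvectors of `(z₀ B - A)⁻¹ B` are eigenvectors of the pencil. -/
theorem mulVec_eq_of_resolvent_eigenvector (h₀ : (z₀ • B - A).det ≠ 0) {ν : ℂ} (hν : ν ≠ 0)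
    {x : Fin n → ℂ} (h : ((z₀ • B - A)⁻¹ * B) *ᵥ x = ν • x) :
    A *ᵥ x = (z₀ - ν⁻¹) • (B *ᵥ x) := by
  have h1 : B *ᵥ x = ν • ((z₀ • B - A) *ᵥ x) := by
    rw [← mulVec_smul, ← h, mulVec_mulVec, mul_nonsing_inv_cancel_left _ _ h₀.isUnit]
  have h2 : ν⁻¹ • (B *ᵥ x) = z₀ • (B *ᵥ x) - A *ᵥ x := by
    conv_lhs => rw [h1]
    rw [smul_smul, inv_mul_cancel₀ hν, one_smul, sub_mulVec, smul_mulVec]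
  rw [sub_smul, h2]
  abel

/-- On each generalized eigenspace of `(z₀ B - A)⁻¹ B` the matrix `Q` is the identity or zero,
according to whether the eigenvalue of the pencil it belongs to lies inside the curve. -/
theorem spectralProjector_mulVec_of_genEigenvector (hγ : IsPositiveSimpleClosedCurve γ a b)
    (hK : ∀ z ∈ γ '' Icc a b, (z • B - A).det ≠ 0) (h₀ : (z₀ • B - A).det ≠ 0)
    {ν : ℂ} (hν : ν ≠ 0) (hl : z₀ - ν⁻¹ ∉ γ '' Icc a b) {k : ℕ} {x : Fin n → ℂ}
    (hx : (((z₀ • B - A)⁻¹ * B - ν • 1) ^ k) *ᵥ x = 0) :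
    (z₀ - ν⁻¹ ∈ inside γ a b → spectralProjector A B γ a b *ᵥ x = x) ∧
      (z₀ - ν⁻¹ ∉ inside γ a b → spectralProjector A B γ a b *ᵥ x = 0) := by
  have key : ∀ i, (spectralProjector A B γ a b *ᵥ x) i = (2 * Real.pi * Complex.I)⁻¹ *
      (x i * contourIntegral γ a b (fun z => (z - (z₀ - ν⁻¹))⁻¹)) := fun i => by
    have h := contourIntegral_resolvent_of_genEigenvector hγ hK h₀ hν hl i k x hx 0
    simp only [pow_zero, one_mul, zero_add, pow_one] at h
    rw [spectralProjector_mulVec hγ hK, h]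
  constructor
  · intro hin
    ext i
    rw [key, mul_left_comm, hγ.positive _ hin, mul_one]
  · intro hout
    ext i
    rw [key, hγ.winding_eq_zero hl hout]
    simp

theorem spectralProjector_mulVec_of_nilpotent (hγ : IsPositiveSimpleClosedCurve γ a b)
    (hK : ∀ z ∈ γ '' Icc a b, (z • B - A).det ≠ 0) (h₀ : (z₀ • B - A).det ≠ 0)
    {k : ℕ} {x : Fin n → ℂ} (hx : (((z₀ • B - A)⁻¹ * B) ^ k) *ᵥ x = 0) :
    spectralProjector A B γ a b *ᵥ x = 0 := by
  ext i
  have h := contourIntegral_resolvent_of_nilpotent hγ hK h₀ i k x hx 0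
  simp only [pow_zero, one_mul] at h
  rw [spectralProjector_mulVec hγ hK, h]
  simp

theorem not_isEigenpair_of_det_ne_zero {z : ℂ} (h : (z • B - A).det ≠ 0) (x : Fin n → ℂ) :
    ¬ IsEigenpair A B z x := fun hx => by
  refine h (exists_mulVec_eq_zero_iff.1 ⟨x, hx.1, ?_⟩)
  rw [sub_mulVec, smul_mulVec, hx.2, sub_self]

/-- A nonzero generalized eigenvector forces an eigenvector. -/
theorem exists_eigenvector_of_pow_mulVec {M : Matrix (Fin n) (Fin n) ℂ} {k : ℕ} {x : Fin n → ℂ}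
    (hx : (M ^ k) *ᵥ x = 0) (hx0 : x ≠ 0) : ∃ y, y ≠ 0 ∧ M *ᵥ y = 0 := by
  refine exists_mulVec_eq_zero_iff.2 ?_
  have := exists_mulVec_eq_zero_iff.1 ⟨x, hx0, hx⟩
  rw [det_pow] at this
  exact eq_zero_of_pow_eq_zero this

/-- The alternative depends on `ν` alone, so `x` and `M x` fall under the same case; commutation
with `M` rests on this. -/
theorem spectralProjector_genEigenspace (hγ : IsPositiveSimpleClosedCurve γ a b)
    (hK : ∀ z ∈ γ '' Icc a b, (z • B - A).det ≠ 0) (h₀ : (z₀ • B - A).det ≠ 0) (ν : ℂ) :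
    (∀ (k : ℕ) (x : Fin n → ℂ), (((z₀ • B - A)⁻¹ * B - ν • 1) ^ k) *ᵥ x = 0 →
      spectralProjector A B γ a b *ᵥ x = x) ∨
    (∀ (k : ℕ) (x : Fin n → ℂ), (((z₀ • B - A)⁻¹ * B - ν • 1) ^ k) *ᵥ x = 0 →
      spectralProjector A B γ a b *ᵥ x = 0) := by
  by_cases hν : ν = 0
  · right
    intro k x hx
    rw [hν, zero_smul, sub_zero] at hx
    exact spectralProjector_mulVec_of_nilpotent hγ hK h₀ hx
  -- Here the generalized eigenspace is zero, since otherwise the pencil would have an eigenvalue on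
  -- the curve.
  by_cases hl : z₀ - ν⁻¹ ∈ γ '' Icc a b
  · right
    intro k x hx
    by_contra hne
    have hx0 : x ≠ 0 := by rintro rfl; simp at hne
    obtain ⟨y, hy0, hy⟩ := exists_eigenvector_of_pow_mulVec hx hx0
    rw [sub_mulVec, smul_mulVec, one_mulVec, sub_eq_zero] at hy
    exact not_isEigenpair_of_det_ne_zero (hK _ hl) y
      ⟨hy0, mulVec_eq_of_resolvent_eigenvector h₀ hν hy⟩
  by_cases hin : z₀ - ν⁻¹ ∈ inside γ a b
  · exact Or.inl fun k x hx =>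
      (spectralProjector_mulVec_of_genEigenvector hγ hK h₀ hν hl hx).1 hin
  · exact Or.inr fun k x hx =>
      (spectralProjector_mulVec_of_genEigenvector hγ hK h₀ hν hl hx).2 hin

/-- Two matrices agree if they agree on all generalized eigenvectors of a third. -/
theorem eq_of_forall_genEigenvector (M : Matrix (Fin n) (Fin n) ℂ) {Q₁ Q₂ : Matrix (Fin n) (Fin n) ℂ}
    (h : ∀ (ν : ℂ) (k : ℕ) (x : Fin n → ℂ), ((M - ν • 1) ^ k) *ᵥ x = 0 → Q₁ *ᵥ x = Q₂ *ᵥ x) :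
    Q₁ = Q₂ := by
  refine Matrix.toLin'.injective (LinearMap.ext fun x => ?_)
  have hx : x ∈ ⨆ ν, Module.End.maxGenEigenspace (toLin' M) ν := by
    rw [Module.End.iSup_maxGenEigenspace_eq_top]; trivial
  induction hx using Submodule.iSup_induction' with
  | mem ν x hx =>
    obtain ⟨k, hk⟩ := Module.End.mem_maxGenEigenspace _ _ _ |>.1 hx
    refine h ν k x ?_
    rw [← toLin'_apply, toLin'_pow, map_sub, map_smul, toLin'_one]
    exact hk
  | zero => simp
  | add x y _ _ hx hy => rw [map_add, map_add, hx, hy]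

theorem spectralProjector_mul_self (hγ : IsPositiveSimpleClosedCurve γ a b)
    (hK : ∀ z ∈ γ '' Icc a b, (z • B - A).det ≠ 0) (h₀ : (z₀ • B - A).det ≠ 0) :
    spectralProjector A B γ a b * spectralProjector A B γ a b = spectralProjector A B γ a b := by
  refine eq_of_forall_genEigenvector ((z₀ • B - A)⁻¹ * B) fun ν k x hx => ?_
  rw [← mulVec_mulVec]
  rcases spectralProjector_genEigenspace hγ hK h₀ ν with h | h
  · rw [h k x hx, h k x hx]
  · rw [h k x hx, mulVec_zero]

theorem spectralProjector_comm (hγ : IsPositiveSimpleClosedCurve γ a b)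
    (hK : ∀ z ∈ γ '' Icc a b, (z • B - A).det ≠ 0) (h₀ : (z₀ • B - A).det ≠ 0) :
    spectralProjector A B γ a b * ((z₀ • B - A)⁻¹ * B) =
      ((z₀ • B - A)⁻¹ * B) * spectralProjector A B γ a b := by
  set M := (z₀ • B - A)⁻¹ * B with hM
  refine eq_of_forall_genEigenvector M fun ν k x hx => ?_
  have hMx : ((M - ν • 1) ^ k) *ᵥ (M *ᵥ x) = 0 := by
    have hc : Commute M ((M - ν • 1) ^ k) :=
      ((Commute.refl M).sub_right ((Commute.one_right M).smul_right ν)).pow_right k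
    rw [mulVec_mulVec, ← hc.eq, ← mulVec_mulVec, hx, mulVec_zero]
  rw [← mulVec_mulVec x _ M, ← mulVec_mulVec x M]
  rcases spectralProjector_genEigenspace hγ hK h₀ ν with h | h
  · rw [h k _ hMx, h k x hx]
  · rw [h k _ hMx, h k x hx, mulVec_zero]

theorem resolvent_eigenvector_of_isEigenpair (h₀ : (z₀ • B - A).det ≠ 0) {l : ℂ} {x : Fin n → ℂ}
    (hx : IsEigenpair A B l x) :
    z₀ ≠ l ∧ ((z₀ • B - A)⁻¹ * B) *ᵥ x = (z₀ - l)⁻¹ • x := by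
  have hne : z₀ ≠ l := fun h => not_isEigenpair_of_det_ne_zero h₀ x (h ▸ hx)
  refine ⟨hne, ?_⟩
  have h1 : (z₀ • B - A) *ᵥ x = (z₀ - l) • (B *ᵥ x) := by
    rw [sub_mulVec, smul_mulVec, hx.2, sub_smul]
  have h2 : B *ᵥ x = (z₀ • B - A) *ᵥ ((z₀ - l)⁻¹ • x) := by
    rw [mulVec_smul, h1, smul_smul, inv_mul_cancel₀ (sub_ne_zero.2 hne), one_smul]
  rw [← mulVec_mulVec, h2, mulVec_mulVec, nonsing_inv_mul _ h₀.isUnit, one_mulVec]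

theorem IsEigenpair.spectralProjector_mulVec (hγ : IsPositiveSimpleClosedCurve γ a b)
    (hK : ∀ z ∈ γ '' Icc a b, (z • B - A).det ≠ 0) (h₀ : (z₀ • B - A).det ≠ 0)
    {l : ℂ} {x : Fin n → ℂ} (hx : IsEigenpair A B l x) :
    (l ∈ inside γ a b → spectralProjector A B γ a b *ᵥ x = x) ∧
      (l ∉ inside γ a b → spectralProjector A B γ a b *ᵥ x = 0) := by
  obtain ⟨hne, h⟩ := resolvent_eigenvector_of_isEigenpair h₀ hx
  have hl : l ∉ γ '' Icc a b := fun h => not_isEigenpair_of_det_ne_zero (hK l h) x hx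
  have e : z₀ - (z₀ - l)⁻¹⁻¹ = l := by rw [inv_inv]; ring
  have := spectralProjector_mulVec_of_genEigenvector hγ hK h₀ (ν := (z₀ - l)⁻¹)
    (inv_ne_zero (sub_ne_zero.2 hne)) (by rwa [e]) (k := 1) (x := x)
    (by rw [pow_one, sub_mulVec, smul_mulVec, one_mulVec, h, sub_self])
  rwa [e] at this

end Projector

/-! ### Polynomials in independent atomless variables -/

section Probability

/-- The zero set of a nonzero polynomial is null for a product of atomless measures. -/
theorem ae_eval_ne_zero_of_ne_zero : ∀ {N : ℕ} (μ : Fin N → Measure ℂ)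
    [∀ i, IsProbabilityMeasure (μ i)] (_ : ∀ i c, μ i {c} = 0)
    {p : MvPolynomial (Fin N) ℂ} (_ : p ≠ 0), ∀ᵐ x ∂Measure.pi μ, MvPolynomial.eval x p ≠ 0
  | 0, μ, _, _, p, hp => by
    refine Filter.Eventually.of_forall fun x h => hp ?_
    refine MvPolynomial.funext fun y => ?_
    rw [Subsingleton.elim y x, h, map_zero]
  | N + 1, μ, _, hμ, p, hp => by
    have hmp := measurePreserving_piFinSuccAbove μ 0
    set q : Polynomial (MvPolynomial (Fin N) ℂ) := MvPolynomial.finSuccEquiv ℂ N p with hq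
    have hq0 : q ≠ 0 := by
      rwa [hq, Ne, EmbeddingLike.map_eq_zero_iff]
    have hcont : Continuous fun y : ℂ × (Fin N → ℂ) =>
        MvPolynomial.eval (Fin.cons y.1 y.2) p := by
      refine (MvPolynomial.continuous_eval p).comp ?_
      refine continuous_pi fun i => ?_
      refine Fin.cases ?_ (fun i => ?_) i
      · simpa using continuous_fst
      · exact (continuous_apply i).comp continuous_snd
    have hmeas : MeasurableSet {y : ℂ × (Fin N → ℂ) |
        MvPolynomial.eval (Fin.cons y.1 y.2) p ≠ 0} :=
      (isOpen_ne_fun hcont continuous_const).measurableSet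
    have key : ∀ᵐ y ∂(μ 0).prod (Measure.pi fun j => μ (Fin.succAbove 0 j)),
        MvPolynomial.eval (Fin.cons y.1 y.2) p ≠ 0 := by
      -- Fubini, with the tail `y` fixed first: by induction the leading coefficient is almost
      -- surely nonzero at `y`, and then only finitely many values of the first coordinate are
      -- roots.
      rw [Measure.ae_prod_iff_ae_ae hmeas, Measure.ae_ae_comm hmeas]
      filter_upwards [ae_eval_ne_zero_of_ne_zero (fun j => μ (Fin.succAbove 0 j))
        (fun j c => hμ _ c) (Polynomial.leadingCoeff_ne_zero.2 hq0)] with y hy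
      have hr : q.map (MvPolynomial.eval y) ≠ 0 := fun h => by
        have := congrArg (fun r => r.coeff q.natDegree) h
        simp only [coeff_map, coeff_zero] at this
        exact hy this
      have : NullSingletonClass (μ 0) := ⟨hμ 0⟩
      have hfin : (μ 0) {x | (q.map (MvPolynomial.eval y)).IsRoot x} = 0 :=
        (((q.map (MvPolynomial.eval y)).finite_setOfPred_isRoot hr).countable).measure_zero _
      rw [ae_iff]
      refine measure_mono_null (fun x hx => ?_) hfin
      simpa [MvPolynomial.eval_eq_eval_mv_eval', hq] using hx
    have := hmp.quasiMeasurePreserving.ae key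
    filter_upwards [this] with x hx
    have e : (Fin.cons (MeasurableEquiv.piFinSuccAbove (fun _ => ℂ) 0 x).1
        (MeasurableEquiv.piFinSuccAbove (fun _ => ℂ) 0 x).2 : Fin (N + 1) → ℂ) = x := by
      ext i
      refine Fin.cases ?_ (fun i => ?_) i <;> rfl
    rwa [e] at hx

variable {Ω : Type*} [MeasurableSpace Ω] {P : Measure Ω} [IsProbabilityMeasure P]

/-- A nonzero polynomial in independent random variables with continuous distributions almost
surely does not vanish. -/
theorem ae_eval_ne_zero_of_iIndepFun {σ : Type*} [Fintype σ] {X : σ → Ω → ℂ}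
    (hX : ∀ i, AEMeasurable (X i) P) (hind : iIndepFun X P)
    (hc : ∀ i c, P {ω | X i ω = c} = 0) {p : MvPolynomial σ ℂ} (hp : p ≠ 0) :
    ∀ᵐ ω ∂P, MvPolynomial.eval (fun i => X i ω) p ≠ 0 := by
  let e := Fintype.equivFin σ
  let X' : Fin (Fintype.card σ) → Ω → ℂ := fun i => X (e.symm i)
  have hX' : ∀ i, AEMeasurable (X' i) P := fun i => hX _
  have hind' : iIndepFun X' P := hind.precomp e.symm.injective
  have hmap := (iIndepFun_iff_map_fun_eq_pi_map hX').1 hind'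
  have : ∀ i, IsProbabilityMeasure (P.map (X' i)) := fun i =>
    Measure.isProbabilityMeasure_map (hX' i)
  have h := ae_eval_ne_zero_of_ne_zero (fun i => P.map (X' i)) (fun i c => ?_)
    (p := MvPolynomial.rename e p) (by
      rwa [Ne, map_eq_zero_iff _ (MvPolynomial.rename_injective _ e.injective)])
  · rw [← hmap] at h
    filter_upwards [ae_of_ae_map (aemeasurable_pi_lambda _ hX') h] with ω hω
    rw [MvPolynomial.eval_rename] at hω
    have e' : (fun i => X' i ω) ∘ e = fun i => X i ω := by
      ext i
      simp [X']
    rwa [e'] at hω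
  · rw [Measure.map_apply_of_aemeasurable (hX' i) (measurableSet_singleton c)]
    exact hc (e.symm i) c

/-- The determinant is a polynomial in the entries of `Y`, and it takes the value `1` at `S`. -/
theorem IsIIDContinuous.ae_det_mul_ne_zero {n s : ℕ} {Y : Ω → Matrix (Fin n) (Fin s) ℂ}
    (hY : IsIIDContinuous P Y) {T : Matrix (Fin s) (Fin n) ℂ} {S : Matrix (Fin n) (Fin s) ℂ}
    (hTS : T * S = 1) : ∀ᵐ ω ∂P, (T * Y ω).det ≠ 0 := by
  let W : Matrix (Fin n) (Fin s) (MvPolynomial (Fin n × Fin s) ℂ) :=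
    Matrix.of fun i j => MvPolynomial.X (i, j)
  let p : MvPolynomial (Fin n × Fin s) ℂ := (T.map MvPolynomial.C * W).det
  have hp : ∀ Z : Matrix (Fin n) (Fin s) ℂ,
      MvPolynomial.eval (fun q => Z q.1 q.2) p = (T * Z).det := by
    intro Z
    let f : MvPolynomial (Fin n × Fin s) ℂ →+* ℂ := MvPolynomial.eval fun q => Z q.1 q.2
    have hT : (T.map MvPolynomial.C).map f = T := by
      ext i j
      exact MvPolynomial.eval_C _
    have hW : W.map f = Z := by
      ext i j
      exact MvPolynomial.eval_X _
    refine (RingHom.map_det f _).trans (congrArg Matrix.det ?_)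
    exact (Matrix.map_mul (f := f)).trans (by rw [hT, hW])
  have hp0 : p ≠ 0 := fun h => by
    have := hp S
    rw [h, hTS] at this
    simp at this
  -- Measurability of an entry is read off from its being identically distributed with itself.
  filter_upwards [ae_eval_ne_zero_of_iIndepFun (fun q => (hY.ident q q).aemeasurable_fst) hY.indep
    hY.continuous hp0] with ω hω
  rwa [← hp]

end Probability

/-! ### Compression to the deflating subspace -/

/-- In a basis of the range of `Q`, `S` is the inclusion and `T` is `Q` with restricted codomain;
`Q` fixes its range, which gives `T S = 1`. -/
theorem exists_factorization_of_idempotent {n : ℕ} {Q : Matrix (Fin n) (Fin n) ℂ}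
    (hQ : Q * Q = Q) : ∃ (r : ℕ) (S : Matrix (Fin n) (Fin r) ℂ) (T : Matrix (Fin r) (Fin n) ℂ),
      S * T = Q ∧ T * S = 1 := by
  let W := LinearMap.range (toLin' Q)
  let e := (Module.finBasis ℂ W).equivFun
  refine ⟨_, LinearMap.toMatrix' (W.subtype ∘ₗ e.symm.toLinearMap),
    LinearMap.toMatrix' (e.toLinearMap ∘ₗ (toLin' Q).rangeRestrict), ?_, ?_⟩
  · rw [← LinearMap.toMatrix'_comp]
    conv_rhs => rw [← LinearMap.toMatrix'_toLin' Q]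
    congr 1
    ext x
    simp
  · rw [← LinearMap.toMatrix'_comp, ← LinearMap.toMatrix'_id]
    congr 1
    refine LinearMap.ext fun y => e.symm.injective ?_
    obtain ⟨x, hx⟩ : ∃ x, toLin' Q x = e.symm y := (e.symm y).2
    refine Subtype.ext ?_
    simp only [LinearMap.comp_apply, LinearEquiv.coe_coe, e.symm_apply_apply, LinearMap.id_apply,
      LinearMap.codRestrict_apply, LinearMap.rangeRestrict, Submodule.subtype_apply]
    rw [← hx, toLin'_apply, toLin'_apply, mulVec_mulVec, hQ]

section Pencil

variable {n : ℕ} {A B : Matrix (Fin n) (Fin n) ℂ}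

theorem eval_pencilCharpoly (A B : Matrix (Fin n) (Fin n) ℂ) (z : ℂ) :
    (pencilCharpoly A B).eval z = (z • B - A).det := by
  rw [pencilCharpoly, ← coe_evalRingHom, RingHom.map_det]
  congr 1
  ext i j
  simp
  ring

theorem isEigenpair_iff {z : ℂ} {x : Fin n → ℂ} :
    IsEigenpair A B z x ↔ x ≠ 0 ∧ (z • B - A) *ᵥ x = 0 := by
  rw [IsEigenpair, sub_mulVec, smul_mulVec, sub_eq_zero, eq_comm (a := A *ᵥ x)]

variable {γ : ℝ → ℂ} {a b : ℝ}

/-- The restriction of a regular pencil to its deflating subspace for the eigenvalues inside the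
curve, of which `S` is a basis. -/
theorem exists_compression (hγ : IsPositiveSimpleClosedCurve γ a b)
    (hK : ∀ z ∈ γ '' Icc a b, (z • B - A).det ≠ 0) (hreg : IsRegularPencil A B) :
    ∃ (r : ℕ) (S : Matrix (Fin n) (Fin r) ℂ) (T K : Matrix (Fin r) (Fin n) ℂ)
      (J : Matrix (Fin r) (Fin r) ℂ), S * T = spectralProjector A B γ a b ∧ T * S = 1 ∧
        K * (B * S) = 1 ∧ A * S = B * S * J ∧ J.charpoly.roots = eigenvaluesInside A B γ a b := by
  obtain ⟨z₀, h₀⟩ := hreg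
  have hcomm := spectralProjector_comm hγ hK h₀
  have hQQ := spectralProjector_mul_self hγ hK h₀
  have heig := fun (l : ℂ) (x : Fin n → ℂ) (hx : IsEigenpair A B l x) =>
    hx.spectralProjector_mulVec hγ hK h₀
  have hnil := fun (x : Fin n → ℂ) (hx : ((z₀ • B - A)⁻¹ * B) *ᵥ x = 0) =>
    spectralProjector_mulVec_of_nilpotent hγ hK h₀ (k := 1) (x := x) (by rwa [pow_one])
  have hfac := pencil_eq_mul (A := A) (B := B) h₀
  have hD : (z₀ • B - A) * ((z₀ • B - A)⁻¹ * B) = B := mul_nonsing_inv_cancel_left _ _ h₀.isUnit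
  have hD' : (z₀ • B - A)⁻¹ * (z₀ • B - A) = 1 := nonsing_inv_mul _ h₀.isUnit
  have hDA : A = z₀ • B - (z₀ • B - A) := by abel
  generalize spectralProjector A B γ a b = Q at *
  generalize (z₀ • B - A)⁻¹ * B = M at hcomm hnil hfac hD
  generalize (z₀ • B - A)⁻¹ = D' at hD'
  generalize hDdef : z₀ • B - A = D at *
  obtain ⟨r, S, T, hST, hTS⟩ := exists_factorization_of_idempotent hQQ
  have hQS : Q * S = S := by rw [← hST, Matrix.mul_assoc, hTS, Matrix.mul_one]
  have hQSy : ∀ y, Q *ᵥ (S *ᵥ y) = S *ᵥ y := fun y => by rw [mulVec_mulVec, hQS]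
  have hSinj : ∀ y, S *ᵥ y = 0 → y = 0 := fun y hy => by
    rw [← one_mulVec y, ← hTS, ← mulVec_mulVec, hy, mulVec_zero]
  set F := T * M * S with hF
  have hMS : M * S = S * F := by
    rw [hF, ← Matrix.mul_assoc, ← Matrix.mul_assoc, hST, hcomm, Matrix.mul_assoc, hQS]
  -- A kernel vector `y` of `F` gives `M S y = 0`; `Q` kills the kernel of `M` but fixes `S y`.
  have hFdet : F.det ≠ 0 := fun h => by
    obtain ⟨y, hy0, hy⟩ := exists_mulVec_eq_zero_iff.2 h
    refine hy0 (hSinj y ?_)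
    rw [← hQSy]
    refine hnil _ ?_
    rw [mulVec_mulVec, hMS, ← mulVec_mulVec, hy, mulVec_zero]
  have hFF : F * F⁻¹ = 1 := mul_nonsing_inv _ hFdet.isUnit
  have hFF' : F⁻¹ * F = 1 := nonsing_inv_mul _ hFdet.isUnit
  have hBS : B * S = D * S * F := by
    conv_lhs => rw [← hD, Matrix.mul_assoc, hMS]
    rw [Matrix.mul_assoc]
  -- The matrix form of `l = z₀ - ν⁻¹`.
  set J := z₀ • (1 : Matrix (Fin r) (Fin r) ℂ) - F⁻¹ with hJ
  have hAS : A * S = B * S * J := by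
    have h1 : B * S * F⁻¹ = D * S := by rw [hBS, Matrix.mul_assoc, hFF, Matrix.mul_one]
    rw [hJ, Matrix.mul_sub, Matrix.mul_smul, Matrix.mul_one, h1]
    conv_lhs => rw [hDA]
    rw [Matrix.sub_mul, Matrix.smul_mul]
  have hSJ : ∀ (z : ℂ) (y : Fin r → ℂ), J *ᵥ y = z • y →
      A *ᵥ (S *ᵥ y) = z • (B *ᵥ (S *ᵥ y)) := fun z y hy => by
    rw [mulVec_mulVec, hAS, ← mulVec_mulVec, hy, mulVec_smul, mulVec_mulVec]
  set N := M * (1 - Q) with hN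
  have hQN : Q * N = 0 := by
    rw [hN, ← Matrix.mul_assoc, hcomm, Matrix.mul_assoc, Matrix.mul_sub, Matrix.mul_one, hQQ,
      sub_self, Matrix.mul_zero]
  -- Since `M Q N = 0`, `1 + (z - z₀) M` splits into its parts for `M Q` and `N`, and `det (1 + XY)
  -- = det (1 + YX)` shrinks the first to size `r`. The pencil `(z₀ N - 1, N)` is chosen so that its
  -- value at `z` is `1 + (z - z₀) N`.
  have hpoly : pencilCharpoly A B =
      Polynomial.C (D.det * F.det) * (J.charpoly * pencilCharpoly (z₀ • N - 1) N) := by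
    refine Polynomial.funext fun z => ?_
    rw [eval_mul, eval_mul, eval_C, eval_pencilCharpoly, eval_pencilCharpoly, eval_charpoly, hfac,
      det_mul]
    have e1 : 1 + (z - z₀) • M = (1 + (z - z₀) • (M * S) * T) * (1 + (z - z₀) • N) := by
      have hMST : (z - z₀) • (M * S) * T = (z - z₀) • (M * Q) := by
        rw [Matrix.smul_mul, Matrix.mul_assoc, hST]
      have h0 : M * Q * N = 0 := by rw [Matrix.mul_assoc, hQN, Matrix.mul_zero]
      rw [hMST, add_mul, one_mul, mul_add, mul_one, Matrix.smul_mul, Matrix.mul_smul, h0, hN,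
        Matrix.mul_sub, Matrix.mul_one, smul_sub]
      simp only [smul_zero, add_zero]
      abel
    have e2 : 1 + T * ((z - z₀) • (M * S)) = F * (scalar (Fin r) z - J) := by
      rw [Matrix.mul_smul, ← Matrix.mul_assoc, ← hF, hJ, scalar_apply, ← smul_one_eq_diagonal, mul_sub,
        mul_sub, Matrix.mul_smul, Matrix.mul_smul, hFF, mul_one, sub_smul]
      abel
    have e3 : z • N - (z₀ • N - 1) = 1 + (z - z₀) • N := by rw [sub_smul]; abel
    rw [e1, det_mul, det_one_add_mul_comm, e2, det_mul, e3]
    ring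
  have hne : pencilCharpoly A B ≠ 0 := fun h => by
    have := eval_pencilCharpoly A B z₀
    rw [h, eval_zero, hDdef] at this
    exact h₀ this.symm
  have hne2 : J.charpoly * pencilCharpoly (z₀ • N - 1) N ≠ 0 := fun h => by
    rw [h, mul_zero] at hpoly
    exact hne hpoly
  have hin : ∀ z ∈ J.charpoly.roots, z ∈ inside γ a b := fun z hz => by
    have h := (mem_roots'.1 hz).2
    rw [IsRoot.def, eval_charpoly] at h
    obtain ⟨y, hy0, hy⟩ := exists_mulVec_eq_zero_iff.2 h
    have hSy : S *ᵥ y ≠ 0 := fun h => hy0 (hSinj y h)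
    have hJy : J *ᵥ y = z • y := by
      rw [scalar_apply, ← smul_one_eq_diagonal, sub_mulVec, smul_mulVec, one_mulVec, sub_eq_zero] at hy
      exact hy.symm
    by_contra hout
    have := (heig z _ ⟨hSy, hSJ z y hJy⟩).2 hout
    rw [hQSy] at this
    exact hSy this
  -- A null vector of the second factor is an eigenvector of the pencil killed by `Q`, whereas `Q`
  -- fixes eigenvectors for eigenvalues inside.
  have hout : ∀ z ∈ (pencilCharpoly (z₀ • N - 1) N).roots, z ∉ inside γ a b := fun z hz hzin => by
    have h := (mem_roots'.1 hz).2
    rw [IsRoot.def, eval_pencilCharpoly] at h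
    obtain ⟨x, hx0, hx⟩ := exists_mulVec_eq_zero_iff.2 h
    have e3 : z • N - (z₀ • N - 1) = 1 + (z - z₀) • N := by rw [sub_smul]; abel
    rw [e3] at hx
    have hQx : Q *ᵥ x = 0 := by
      have := congrArg (fun v => Q *ᵥ v) hx
      simpa [mulVec_mulVec, mul_add, hQN] using this
    have hNx : N *ᵥ x = M *ᵥ x := by
      rw [hN, ← mulVec_mulVec, sub_mulVec, one_mulVec, hQx, sub_zero]
    have hpair : IsEigenpair A B z x := by
      refine isEigenpair_iff.2 ⟨hx0, ?_⟩
      rw [add_mulVec, smul_mulVec, hNx, ← smul_mulVec, ← add_mulVec] at hx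
      rw [hfac, ← mulVec_mulVec, hx, mulVec_zero]
    exact hx0 (((heig z x hpair).1 hzin).symm.trans hQx)
  -- The left inverse of `B S` comes from `D' B S = M S = S F`.
  refine ⟨r, S, T, F⁻¹ * T * D', J, hST, hTS, ?_, hAS, ?_⟩
  · rw [Matrix.mul_assoc, ← Matrix.mul_assoc D', ← hD, ← Matrix.mul_assoc D' D, hD',
      Matrix.one_mul, hMS, Matrix.mul_assoc,
      ← Matrix.mul_assoc T, hTS, Matrix.one_mul, hFF']
  · classical
    rw [eigenvaluesInside, eigenvalues, hpoly, roots_C_mul _ (mul_ne_zero h₀ hFdet),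
      roots_mul hne2, Multiset.filter_add, Multiset.filter_eq_self.2 hin,
      Multiset.filter_eq_nil.2 hout, add_zero]

end Pencil

end Feast

end

/-! ### The reduced random pencil -/

theorem theorem4p1 {n s : ℕ} (A B : Matrix (Fin n) (Fin n) ℂ)
    (hreg : Feast.IsRegularPencil A B)
    (γ : ℝ → ℂ) (a b : ℝ) (hγ : Feast.IsPositiveSimpleClosedCurve γ a b)
    (hΓ : ∀ z ∈ γ '' Set.Icc a b, ∀ x : Fin n → ℂ, ¬ Feast.IsEigenpair A B z x)
    (hs : (Feast.eigenvaluesInside A B γ a b).card = s)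
    {Ω : Type*} [MeasurableSpace Ω] (P : MeasureTheory.Measure Ω)
    [MeasureTheory.IsProbabilityMeasure P]
    (Y R : Ω → Matrix (Fin n) (Fin s) ℂ)
    (hY : Feast.IsIIDContinuous P Y) (hR : Feast.IsIIDContinuous P R) :
    ∀ᵐ ω ∂P, ∀ (U : Matrix (Fin n) (Fin s) ℂ) (A' B' : Matrix (Fin s) (Fin s) ℂ),
      U = Feast.spectralProjector A B γ a b * Y ω →
      A' = (R ω)ᴴ * A * U →
      B' = (R ω)ᴴ * B * U →
      Feast.IsRegularPencil A' B' ∧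
      Feast.eigenvalues A' B' = Feast.eigenvaluesInside A B γ a b ∧
      (∀ (μ : ℂ) (y : Fin s → ℂ), Feast.IsEigenpair A' B' μ y →
        μ ∈ Feast.inside γ a b ∧ Feast.IsEigenpair A B μ (U *ᵥ y)) ∧
      (∀ μ ∈ Feast.inside γ a b, ∀ x : Fin n → ℂ, Feast.IsEigenpair A B μ x →
        ∃! y : Fin s → ℂ, Feast.IsEigenpair A' B' μ y ∧ U *ᵥ y = x) := by
  have hK : ∀ z ∈ γ '' Set.Icc a b, (z • B - A).det ≠ 0 := fun z hz =>
    Feast.det_ne_zero_of_forall_not_isEigenpair (hΓ z hz)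
  obtain ⟨r, S, T, K, J, hST, hTS, hKS, hAS, hroots⟩ := Feast.exists_compression hγ hK hreg
  -- The rank of `Q` is the degree of the characteristic polynomial of `J`, hence the number of its
  -- roots.
  obtain rfl : r = s := by
    rw [← hs, ← hroots, IsAlgClosed.card_roots_eq_natDegree, charpoly_natDegree_eq_dim,
      Fintype.card_fin]
  -- The adjoint of `G` is used because it is linear in the entries of `R`, while `G` involves their
  -- conjugates.
  have hKS' : (B * S)ᴴ * Kᴴ = 1 := by rw [← conjTranspose_mul, hKS, conjTranspose_one]
  filter_upwards [hY.ae_det_mul_ne_zero hTS, hR.ae_det_mul_ne_zero hKS'] with ω hYω hRω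
  rintro U A' B' rfl rfl rfl
  set L := T * Y ω with hL
  set G := (R ω)ᴴ * (B * S) with hG
  have hGdet : G.det ≠ 0 := fun h => hRω (by
    have : (B * S)ᴴ * R ω = Gᴴ := by
      rw [hG, conjTranspose_mul (R ω)ᴴ, conjTranspose_conjTranspose]
    rw [this, det_conjTranspose, h, star_zero])
  have hU : Feast.spectralProjector A B γ a b * Y ω = S * L := by rw [← hST, Matrix.mul_assoc]
  have hB' : (R ω)ᴴ * B * (S * L) = G * L := by simp only [hG, Matrix.mul_assoc]
  have hA' : (R ω)ᴴ * A * (S * L) = G * J * L := by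
    rw [Matrix.mul_assoc, ← Matrix.mul_assoc A, hAS]
    simp only [hG, Matrix.mul_assoc]
  rw [hU, hA', hB']
  have hdet : ∀ z : ℂ, (z • (G * L) - G * J * L).det = G.det * L.det * J.charpoly.eval z := by
    intro z
    have e : z • (G * L) - G * J * L = G * (scalar (Fin r) z - J) * L := by
      rw [scalar_apply, ← smul_one_eq_diagonal, mul_sub, sub_mul, Matrix.mul_smul, mul_one,
        Matrix.smul_mul]
    rw [e, det_mul, det_mul, eval_charpoly]
    ring
  have hpoly : Feast.pencilCharpoly (G * J * L) (G * L) =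
      Polynomial.C (G.det * L.det) * J.charpoly :=
    Polynomial.funext fun z => by
      rw [Feast.eval_pencilCharpoly, hdet, Polynomial.eval_mul, Polynomial.eval_C]
  have hGLne : G.det * L.det ≠ 0 := mul_ne_zero hGdet hYω
  have hLinj : ∀ y, L *ᵥ y = 0 → y = 0 := fun y hy => by
    by_contra h
    exact hYω (exists_mulVec_eq_zero_iff.1 ⟨y, h, hy⟩)
  have hSinj : ∀ y, S *ᵥ y = 0 → y = 0 := fun y hy => by
    rw [← one_mulVec y, ← hTS, ← mulVec_mulVec, hy, mulVec_zero]
  have hGinj : ∀ y, G *ᵥ y = 0 → y = 0 := fun y hy => by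
    by_contra h
    exact hGdet (exists_mulVec_eq_zero_iff.1 ⟨y, h, hy⟩)
  refine ⟨?_, ?_, ?_, ?_⟩
  · obtain ⟨z, hz⟩ : ∃ z, J.charpoly.eval z ≠ 0 := by
      by_contra! h
      exact (charpoly_monic J).ne_zero (Polynomial.funext fun z => by rw [h, Polynomial.eval_zero])
    exact ⟨z, by rw [hdet]; exact mul_ne_zero hGLne hz⟩
  · rw [Feast.eigenvalues, hpoly, Polynomial.roots_C_mul _ hGLne, hroots]
  · rintro μ y ⟨hy0, hy⟩
    have hJ : J *ᵥ (L *ᵥ y) = μ • (L *ᵥ y) := by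
      refine sub_eq_zero.1 (hGinj _ ?_)
      rw [mulVec_sub, mulVec_smul, mulVec_mulVec, mulVec_mulVec, mulVec_mulVec, hy, sub_self]
    have hne : S *ᵥ (L *ᵥ y) ≠ 0 := fun h => hy0 (hLinj y (hSinj _ h))
    rw [← mulVec_mulVec]
    refine ⟨?_, hne, ?_⟩
    · have hmem : μ ∈ J.charpoly.roots := by
        refine (Polynomial.mem_roots (charpoly_monic J).ne_zero).2 ?_
        rw [Polynomial.IsRoot.def, eval_charpoly]
        refine exists_mulVec_eq_zero_iff.1 ⟨L *ᵥ y, fun h => hy0 (hLinj y h), ?_⟩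
        rw [scalar_apply, ← smul_one_eq_diagonal, sub_mulVec, smul_mulVec, one_mulVec, hJ, sub_self]
      rw [hroots, Feast.eigenvaluesInside] at hmem
      classical exact (Multiset.mem_filter.1 hmem).2
    · rw [mulVec_mulVec, hAS, ← mulVec_mulVec, hJ, mulVec_smul, ← mulVec_mulVec]
  · intro μ hμ x hx
    obtain ⟨z₀, h₀⟩ := hreg
    have hQx := (hx.spectralProjector_mulVec hγ hK h₀).1 hμ
    have hLL : L * L⁻¹ = 1 := mul_nonsing_inv _ hYω.isUnit
    -- This solves `S L y = x`, since `S T x = Q x = x`.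
    set y := L⁻¹ *ᵥ (T *ᵥ x) with hy
    have hUy : (S * L) *ᵥ y = x := by
      rw [hy, mulVec_mulVec, Matrix.mul_assoc, hLL, Matrix.mul_one, mulVec_mulVec, hST, hQx]
    refine ⟨y, ⟨⟨?_, ?_⟩, hUy⟩, fun y' hy' => ?_⟩
    · intro h
      rw [h, mulVec_zero] at hUy
      exact hx.1 hUy.symm
    · rw [← hA', ← hB', ← mulVec_mulVec, ← mulVec_mulVec, hUy, ← mulVec_mulVec, ← mulVec_mulVec,
        hUy, hx.2, mulVec_smul]
    · refine sub_eq_zero.1 (hLinj _ (hSinj _ ?_))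
      rw [mulVec_mulVec, mulVec_sub, hy'.2, hUy, sub_self]
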